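/- Let $\mathcal H$ be the upper half plane. Let $E_4,E_6$ be the Eisenstein series of weights 4 and 6 and $E_2$ the (conditionally summed) Eisenstein series of weight 2, all normalised to have constant Fourier coefficient 1. Put $E_2^*(\tau)=E_2(\tau)-\frac{3}{\pi\operatorname{Im}\tau}$, $\Delta=(E_4^3-E_6^2)/1728$ and $$j=\frac{E_4^3}{\Delta},\qquad f=\frac{E_4E_6}{\Delta},\qquad \chi=E_2f,\qquad \chi^*=E_2^*f .$$ A *GUT (geodesic upper triangular) variety* in $\mathcal H^n$ is a set of the form $$G=\{(\tau_1,\dots,\tau_n)\in\mathcal H^n:\ \tau_s=q_s\ (s\in S_0),\ \ \tau_s=g_{i,s}\tau_{s_i}\ (s\in S_i,\ s\neq s_i,\ 1\le i\le k)\},$$ where $S_0\cup S_1\cup\dots\cup S_k$ is a partition of $\{1,\dots,n\}$ with $k\ge 0$ and $S_i\neq\emptyset$ for $i>0$, $q_s\in\mathcal H$, $s_i$ is the least element of $S_i$, and the $g_{i,s}\in\operatorname{GL}_2^+(\mathbb Q)$ are upper triangular matrices acting by Möbius transformations. Let $G\subseteq\mathcal H^n$ be a GUT variety, let $F$ be a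 polynomial in $2n$ variables over $\mathbb C$, and let $c_1,\dots,c_n$ be nonzero real constants such that, whenever the $s$-th coordinate is constant on $G$, with value $q_s$, one has $c_s=\operatorname{Im}q_s$. (If no coordinate is constant on $G$, this is no condition.) Suppose that $$F\Bigl(j(\tau_1),\ \chi(\tau_1)-\frac{3}{\pi c_1}f(\tau_1),\ \dots,\ j(\tau_n),\ \chi(\tau_n)-\frac{3}{\pi c_n}f(\tau_n)\Bigr)=0\qquad\text{for all }(\tau_1,\dots,\tau_n)\in G.$$ Then $$F\bigl(j(\tau_1),\chi^*(\tau_1),\dots,j(\tau_n),\chi^*(\tau_n)\bigr)=0\qquad\text{for all }(\tau_1,\dots,\tau_n)\in G.$$ -/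

import Mathlib

open scoped UpperHalfPlane MatrixGroups

noncomputable section

/-- The discriminant function `Δ = (E₄³ - E₆²) / 1728`. -/
def discr (τ : ℍ) : ℂ := (ModularForm.E₄ τ ^ 3 - ModularForm.E₆ τ ^ 2) / 1728

/-- The modular function `j = 1728 E₄³ / (E₄³ - E₆²) = E₄³ / Δ`. -/
def jFun (τ : ℍ) : ℂ :=
  1728 * (ModularForm.E₄ τ ^ 3 / (ModularForm.E₄ τ ^ 3 - ModularForm.E₆ τ ^ 2))

/-- The meromorphic modular form `f = E₄ E₆ / Δ` of weight `-2`. -/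
def fFun (τ : ℍ) : ℂ := ModularForm.E₄ τ * ModularForm.E₆ τ / discr τ

/-- The nonholomorphic Eisenstein series `E₂*(τ) = E₂(τ) - 3 / (π Im τ)`. -/
def E2Star (τ : ℍ) : ℂ := EisensteinSeries.E2 τ - 3 / ((Real.pi : ℂ) * (τ.im : ℂ))

/-- The quasimodular function `χ = E₂ f`. -/
def chi (τ : ℍ) : ℂ := EisensteinSeries.E2 τ * fFun τ

/-- The almost holomorphic modular function `χ* = E₂* f`. -/
def chiStar (τ : ℍ) : ℂ := E2Star τ * fFun τ

/-- The Möbius action of `GL₂⁺(ℚ)` on the upper half plane. -/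
def geodesicAct (g : GL(2, ℚ)⁺) (τ : ℍ) : ℍ :=
  Matrix.GeneralLinearGroup.map (algebraMap ℚ ℝ) (g : GL (Fin 2) ℚ) • τ

/-- The data defining a weakly special subvariety of `ℍⁿ`: a partition
`S₀ ∪ S₁ ∪ ⋯ ∪ S_k` of the set of coordinates, with `S₁, …, S_k` nonempty (`s ∈ S_i` is
`block s = i`), a constant `q s` for each `s ∈ S₀`, and a matrix `g s ∈ GL₂⁺(ℚ)` for each
`s ∈ S_i`, `i > 0`, other than the least element of `S_i`. (The values of `q` and `g` at the other
indices play no role.) -/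
structure WeaklySpecialData (n : ℕ) where
  k : ℕ
  block : Fin n → Fin (k + 1)
  block_nonempty : ∀ i : Fin (k + 1), i ≠ 0 → ∃ s, block s = i
  q : Fin n → ℍ
  g : Fin n → GL(2, ℚ)⁺

namespace WeaklySpecialData

variable {n : ℕ} (D : WeaklySpecialData n)

/-- `r = s_i` is the least element of the block `S_i`, and `s ∈ S_i` with `s ≠ s_i`, for some
`i > 0`. -/
def Related (r s : Fin n) : Prop :=
  ∃ i : Fin (D.k + 1), i ≠ 0 ∧ IsLeast {t | D.block t = i} r ∧ D.block s = i ∧ s ≠ r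

/-- The subset of `ℍⁿ` cut out by the data: `τ_s = q_s` for `s ∈ S₀`, and
`τ_s = g_s τ_{s_i}` for `s ∈ S_i`, `s ≠ s_i`. -/
def carrier : Set (Fin n → ℍ) :=
  {τ | (∀ s, D.block s = 0 → τ s = D.q s) ∧
    ∀ r s, D.Related r s → τ s = geodesicAct (D.g s) (τ r)}

/-- All the matrices occurring in the data are upper triangular. -/
def IsUpperTriangular : Prop :=
  ∀ r s, D.Related r s → ((D.g s : GL (Fin 2) ℚ) : Matrix (Fin 2) (Fin 2) ℚ) 1 0 = 0

end WeaklySpecialData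

/-- A geodesic upper triangular (GUT) variety: a weakly special subvariety of `ℍⁿ` all of whose
relations are given by upper triangular matrices. -/
def IsGUT {n : ℕ} (G : Set (Fin n → ℍ)) : Prop :=
  ∃ D : WeaklySpecialData n, D.IsUpperTriangular ∧ G = D.carrier

end

open Filter Topology

/-! Near a point of `G`, let the free variables `t` of the nonconstant blocks move by `!![1, My; Mx,
1 + M²xy]`. Upper triangular relations are affine, so for divisible `M` every coordinate `at + b`
moves by an element of SL₂(ℤ): `j` stays fixed, while `χ` gains an anomaly proportional to `f`. As
`x → ∞` the `c`-term dies and the anomaly tends to `-(6i/πa) f / (t + My)` (`chi_smul`,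
`exists_conj_mem_SL2Z`). So `F` vanishes for infinitely many values of `u = 1/(t + My)` in each
block independently, hence for all complex `u` (`eval_eq_zero_of_forall_int`); `u = 1/(2i Im t)`
turns `χ` into `χ*`. -/

/-- The weight `k` transformation law of a level one modular form. -/
theorem levelOne_smul {k : ℤ} (f : ModularForm 𝒮ℒ k)
    (γ : SL(2, ℤ)) (τ : ℍ) : f (γ • τ) = UpperHalfPlane.denom γ τ ^ k * f τ :=
  SlashInvariantForm.slash_action_eqn'' f (Γ := 𝒮ℒ)
    (γ := Matrix.SpecialLinearGroup.mapGL ℝ γ) ⟨γ, rfl⟩ τ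

theorem discr_smul (γ : SL(2, ℤ)) (τ : ℍ) :
    discr (γ • τ) = UpperHalfPlane.denom γ τ ^ 12 * discr τ := by
  have h4 := levelOne_smul ModularForm.E₄ γ τ
  have h6 := levelOne_smul ModularForm.E₆ γ τ
  simp only [discr, h4, h6]
  norm_cast
  ring

theorem jFun_smul (γ : SL(2, ℤ)) (τ : ℍ) : jFun (γ • τ) = jFun τ := by
  have h4 := levelOne_smul ModularForm.E₄ γ τ
  have h6 := levelOne_smul ModularForm.E₆ γ τ
  have h0 := UpperHalfPlane.denom_ne_zero γ τ
  simp only [jFun, h4, h6]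
  generalize UpperHalfPlane.denom γ τ = J at *
  have e1 : (J ^ (4 : ℤ) * ModularForm.E₄ τ) ^ 3 = J ^ 12 * ModularForm.E₄ τ ^ 3 := by
    norm_cast; ring
  have e2 : (J ^ (6 : ℤ) * ModularForm.E₆ τ) ^ 2 = J ^ 12 * ModularForm.E₆ τ ^ 2 := by
    norm_cast; ring
  rw [e1, e2, ← mul_sub, mul_div_mul_left _ _ (pow_ne_zero _ h0)]

theorem fFun_smul (γ : SL(2, ℤ)) (τ : ℍ) :
    fFun (γ • τ) = (UpperHalfPlane.denom γ τ)⁻¹ ^ 2 * fFun τ := by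
  have h4 := levelOne_smul ModularForm.E₄ γ τ
  have h6 := levelOne_smul ModularForm.E₆ γ τ
  have h0 := UpperHalfPlane.denom_ne_zero γ τ
  simp only [fFun, discr_smul, h4, h6]
  generalize UpperHalfPlane.denom γ τ = J at *
  have e1 : J ^ (4 : ℤ) * ModularForm.E₄ τ * (J ^ (6 : ℤ) * ModularForm.E₆ τ) =
      J ^ 12 * (J⁻¹ ^ 2 * (ModularForm.E₄ τ * ModularForm.E₆ τ)) := by
    norm_cast; field_simp
  rw [e1, mul_div_mul_left _ _ (pow_ne_zero _ h0), mul_div_assoc]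

theorem E2_smul (γ : SL(2, ℤ)) (τ : ℍ) :
    EisensteinSeries.E2 (γ • τ) = UpperHalfPlane.denom γ τ ^ 2 *
      (EisensteinSeries.E2 τ
        - 6 * Complex.I / Real.pi * ((γ 1 0 : ℂ) / UpperHalfPlane.denom γ τ)) := by
  have h := congrFun (EisensteinSeries.E2_slash_action γ) τ
  have h0 := UpperHalfPlane.denom_ne_zero γ τ
  have hpi : (Real.pi : ℂ) ≠ 0 := mod_cast Real.pi_ne_zero
  rw [ModularForm.SL_slash_apply] at h
  simp only [Pi.sub_apply, Pi.smul_apply, smul_eq_mul, EisensteinSeries.D2, riemannZeta_two] at h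
  generalize UpperHalfPlane.denom γ τ = J at *
  rw [zpow_neg, ← div_eq_mul_inv, div_eq_iff (zpow_ne_zero _ h0)] at h
  rw [h, zpow_ofNat]
  field_simp

/-- The weights 2 and -2 cancel, so only the anomaly of `E2` survives. -/
theorem chi_smul (γ : SL(2, ℤ)) (τ : ℍ) :
    chi (γ • τ) = chi τ
      - 6 * Complex.I / Real.pi * ((γ 1 0 : ℂ) / UpperHalfPlane.denom γ τ) * fFun τ := by
  have h0 := UpperHalfPlane.denom_ne_zero γ τ
  rw [chi, chi, E2_smul, fFun_smul]
  field_simp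

/-! ### Affine maps and integral conjugates -/

/-- An upper triangular element of `GL₂⁺(ℚ)` acts by a rational affine map. -/
theorem geodesicAct_eq_affine (g : GL(2, ℚ)⁺)
    (hg : ((g : GL (Fin 2) ℚ) : Matrix (Fin 2) (Fin 2) ℚ) 1 0 = 0) :
    ∃ a b : ℚ, 0 < a ∧ ∀ τ : ℍ, (geodesicAct g τ : ℂ) = a * τ + b := by
  have hdet : 0 < ((g : GL (Fin 2) ℚ) : Matrix (Fin 2) (Fin 2) ℚ).det := g.2
  have hdetR : 0 < (Matrix.GeneralLinearGroup.map (algebraMap ℚ ℝ) (g : GL (Fin 2) ℚ)).det.val := by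
    rw [Matrix.GeneralLinearGroup.map_det]
    simpa using hdet
  rw [Matrix.det_fin_two, hg, mul_zero, sub_zero] at hdet
  have hd : ((g : GL (Fin 2) ℚ) : Matrix (Fin 2) (Fin 2) ℚ) 1 1 ≠ 0 := by
    rintro h; simp [h] at hdet
  refine ⟨((g : GL (Fin 2) ℚ) : Matrix (Fin 2) (Fin 2) ℚ) 0 0 /
      ((g : GL (Fin 2) ℚ) : Matrix (Fin 2) (Fin 2) ℚ) 1 1,
    ((g : GL (Fin 2) ℚ) : Matrix (Fin 2) (Fin 2) ℚ) 0 1 /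
      ((g : GL (Fin 2) ℚ) : Matrix (Fin 2) (Fin 2) ℚ) 1 1, ?_, fun τ => ?_⟩
  · rw [div_pos_iff]; exact mul_pos_iff.1 hdet
  · rw [geodesicAct, UpperHalfPlane.coe_smul_of_det_pos hdetR]
    simp only [UpperHalfPlane.num, UpperHalfPlane.denom, Matrix.GeneralLinearGroup.map_apply, hg]
    push_cast
    simp
    field_simp

/-- For all sufficiently divisible `M`, the conjugate of `!![1, M y; M x, 1 + M² x y]` by the affine
map `t ↦ a t + b` is integral. -/
theorem exists_conj_mem_SL2Z (a b : ℚ) (ha : 0 < a) :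
    ∃ N : ℕ, 0 < N ∧ ∀ M : ℕ, N ∣ M → ∀ (x y : ℤ) (t t' w w' : ℍ),
      (t' : ℂ) = (t + M * y) / (1 + M * x * (t + M * y)) →
      (w : ℂ) = a * t + b → (w' : ℂ) = a * t' + b →
      ∃ γ : SL(2, ℤ), γ • w = w' ∧ (γ 1 0 : ℂ) = M * x / a ∧
        UpperHalfPlane.denom γ w = 1 + M * x * (t + M * y) := by
  obtain ⟨p, q, r, s, hp, hq, hs, rfl, rfl⟩ : ∃ (p q : ℕ) (r : ℤ) (s : ℕ), 0 < p ∧ 0 < q ∧ 0 < s ∧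
      a = p / q ∧ b = r / s := by
    refine ⟨a.num.toNat, a.den, b.num, b.den, ?_, a.den_pos, b.den_pos, ?_, (b.num_div_den).symm⟩
    · have := Rat.num_pos.2 ha
      omega
    · have h : ((a.num.toNat : ℤ) : ℚ) = a.num := by
        rw [Int.toNat_of_nonneg (Rat.num_pos.2 ha).le]
      rw [Int.cast_natCast] at h
      rw [h, Rat.num_div_den]
  -- The conjugate has terms in `M/a`, `Ma` and `Mb²/a`: `p` clears `1/a`, `q` clears `a`, and `s²`
  -- clears `b²`.
  refine ⟨p * q * s ^ 2, by positivity, ?_⟩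
  rintro _ ⟨K, rfl⟩ x y t t' w w' ht' hw hw'
  have hpC : (p : ℂ) ≠ 0 := mod_cast hp.ne'
  have hqC : (q : ℂ) ≠ 0 := mod_cast hq.ne'
  have hsC : (s : ℂ) ≠ 0 := mod_cast hs.ne'
  let γ : SL(2, ℤ) := ⟨!![1 + r * q ^ 2 * s * K * x,
      (r * p * q * s * K) * (p * q * s ^ 2 * K) * x * y - r ^ 2 * q ^ 2 * K * x
        + p ^ 2 * s ^ 2 * K * y;
      q ^ 2 * s ^ 2 * K * x,
      1 + (p * q * s ^ 2 * K) ^ 2 * x * y - r * q ^ 2 * s * K * x], by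
    rw [Matrix.det_fin_two_of]; ring⟩
  have hden : UpperHalfPlane.denom γ w = 1 + ((p * q * s ^ 2 * K : ℕ) : ℂ) * x *
      (t + ((p * q * s ^ 2 * K : ℕ) : ℂ) * y) := by
    rw [ModularGroup.denom_apply, hw]
    simp [γ]
    field_simp
    ring
  have h0 := UpperHalfPlane.denom_ne_zero γ w
  refine ⟨γ, ?_, ?_, hden⟩
  · ext
    have h1 : ((γ • w : ℍ) : ℂ) = ((γ 0 0 : ℂ) * w + γ 0 1) / UpperHalfPlane.denom γ w := by
      rw [UpperHalfPlane.coe_specialLinearGroup_apply, ModularGroup.denom_apply]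
      simp
    rw [h1, hw', ht', div_eq_iff h0, ← hden, add_mul, mul_assoc, div_mul_cancel₀ _ h0, hden, hw]
    simp [γ]
    field_simp
    ring
  · simp [γ]
    field_simp

/-- The action of `!![1, m; l, 1 + l m]` on the upper half plane. -/
theorem exists_coe_eq_div (l m : ℤ) (t : ℍ) :
    ∃ t' : ℍ, (t' : ℂ) = (t + m) / (1 + l * (t + m)) := by
  let γ : SL(2, ℤ) := ⟨!![1, m; l, 1 + l * m], by rw [Matrix.det_fin_two_of]; ring⟩
  refine ⟨γ • t, ?_⟩
  rw [UpperHalfPlane.coe_specialLinearGroup_apply]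
  simp [γ]
  ring

/-! ### Parametrization of GUT varieties -/

namespace WeaklySpecialData

variable {n : ℕ} (D : WeaklySpecialData n)

theorem exists_isLeast_block (i : Fin (D.k + 1)) (hi : i ≠ 0) :
    ∃ r, IsLeast {t | D.block t = i} r := by
  obtain ⟨s, hs⟩ := D.block_nonempty i hi
  have h : (Finset.univ.filter fun t => D.block t = i).Nonempty := ⟨s, by simpa using hs⟩
  exact ⟨_, by simpa using Finset.isLeast_min' _ h⟩

/-- A GUT variety is parametrized by one free variable for each nonconstant
block, the coordinates being rational affine functions of these variables. -/
theorem exists_affine_parametrization (hD : D.IsUpperTriangular) {τ : Fin n → ℍ}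
    (hτ : τ ∈ D.carrier) :
    ∃ (a b : Fin n → ℚ) (t : Fin (D.k + 1) → ℍ), (∀ s, 0 < a s) ∧
      (∀ s, D.block s ≠ 0 → (τ s : ℂ) = a s * t (D.block s) + b s) ∧
      ∀ t' : Fin (D.k + 1) → ℍ, ∃ τ' ∈ D.carrier, (∀ s, D.block s = 0 → τ' s = τ s) ∧
        ∀ s, D.block s ≠ 0 → (τ' s : ℂ) = a s * t' (D.block s) + b s := by
  classical
  have hrel : ∀ s, D.block s ≠ 0 → ¬ IsLeast {t | D.block t = D.block s} s →
      ∃ r, IsLeast {t | D.block t = D.block s} r ∧ D.Related r s := fun s hs hl => by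
    obtain ⟨r, hr⟩ := D.exists_isLeast_block _ hs
    exact ⟨r, hr, D.block s, hs, hr, rfl, by rintro rfl; exact hl hr⟩
  -- The matrix `D.g s` is junk on `S₀` and at least elements, so the identity replaces it there.
  let act : Fin n → ℍ → ℍ := fun s z =>
    if D.block s = 0 ∨ IsLeast {t | D.block t = D.block s} s then z else geodesicAct (D.g s) z
  have haff : ∀ s, ∃ a b : ℚ, 0 < a ∧ ∀ z : ℍ, (act s z : ℂ) = a * z + b := fun s => by
    by_cases h : D.block s = 0 ∨ IsLeast {t | D.block t = D.block s} s
    · exact ⟨1, 0, one_pos, fun z => by simp [act, h]⟩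
    · obtain ⟨r, -, hr⟩ := hrel s (fun h0 => h (.inl h0)) (fun hl => h (.inr hl))
      obtain ⟨a, b, ha, hab⟩ := geodesicAct_eq_affine (D.g s) (hD r s hr)
      exact ⟨a, b, ha, fun z => by simp only [act, if_neg h, hab]⟩
  choose a b ha hab using haff
  have ht : ∀ i, ∃ z : ℍ, i ≠ 0 → ∀ r, IsLeast {t | D.block t = i} r → τ r = z := fun i => by
    by_cases hi : i = 0
    · exact ⟨UpperHalfPlane.I, fun h => absurd hi h⟩
    · obtain ⟨r, hr⟩ := D.exists_isLeast_block i hi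
      exact ⟨τ r, fun _ r' hr' => by rw [hr'.unique hr]⟩
  choose t ht using ht
  refine ⟨a, b, t, ha, fun s hs => ?_, fun t' => ?_⟩
  · rw [← hab]
    congr 1
    by_cases hl : IsLeast {t | D.block t = D.block s} s
    · simp only [act, hl, or_true, if_true]
      exact ht _ hs s hl
    · obtain ⟨r, hr, hrs⟩ := hrel s hs hl
      simp only [act, hl, hs, or_false, if_false]
      rw [hτ.2 r s hrs, ht _ hs r hr]
  · refine ⟨fun s => if D.block s = 0 then τ s else act s (t' (D.block s)), ⟨fun s hs => ?_, ?_⟩,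
      fun s hs => by simp [hs], fun s hs => by simp [hs, hab]⟩
    · simp only [hs, if_true]
      exact hτ.1 s hs
    · rintro r s ⟨i, hi, hr, rfl, hne⟩
      have hrb : D.block r = D.block s := hr.1
      have hl : ¬ IsLeast {t | D.block t = D.block s} s := fun h => hne (h.unique hr)
      simp only [hi, if_false, act, hl, or_false, hrb]
      rw [if_pos (.inr hr)]

end WeaklySpecialData

/-! ### Limits and polynomial interpolation -/

theorem tendsto_inv_one_add_nat_mul {z : ℂ} (hz : z ≠ 0) :
    Tendsto (fun x : ℕ => (1 + x * z)⁻¹) atTop (𝓝 0) := by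
  refine tendsto_inv₀_cobounded.comp ?_
  have h : Tendsto (fun x : ℕ => (x : ℂ) * z) atTop (Bornology.cobounded ℂ) := by
    rw [← tendsto_norm_atTop_iff_cobounded]
    simpa using tendsto_natCast_atTop_atTop.atTop_mul_const (norm_pos_iff.2 hz)
  exact (tendsto_const_add_cobounded (1 : ℂ)).comp h

theorem tendsto_nat_div_one_add_nat_mul {z : ℂ} (hz : z ≠ 0) :
    Tendsto (fun x : ℕ => (x : ℂ) / (1 + x * z)) atTop (𝓝 z⁻¹) := by
  have h : Tendsto (fun x : ℕ => ((x : ℂ)⁻¹ + z)⁻¹) atTop (𝓝 z⁻¹) := by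
    simpa using ((tendsto_inv_atTop_nhds_zero_nat (𝕜 := ℂ)).add_const z).inv₀ (by simpa using hz)
  refine h.congr' ?_
  filter_upwards [eventually_ne_atTop 0] with x hx
  have : (x : ℂ) ≠ 0 := mod_cast hx
  field_simp

/-- If `F` vanishes at the deformations `(j, χ - λ / (t + M y) f)` of a point, for all integers `y`
in each free variable `t`, then it vanishes at `(j, χ - λ u f)` for all complex `u`. -/
theorem eval_eq_zero_of_forall_int {σ ι : Type*} [Finite ι] (F : MvPolynomial σ ℂ) (t : ι → ℍ)
    {M : ℕ} (hM : M ≠ 0) (A B : σ → ℂ) (β : σ → ι)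
    (h : ∀ y : ι → ℤ, MvPolynomial.eval
      (fun p => A p - B p * ((t (β p) : ℂ) + M * y (β p))⁻¹) F = 0) (u : ι → ℂ) :
    MvPolynomial.eval (fun p => A p - B p * u (β p)) F = 0 := by
  let Q : MvPolynomial ι ℂ := MvPolynomial.bind₁
    (fun p => MvPolynomial.C (A p) - MvPolynomial.C (B p) * MvPolynomial.X (β p)) F
  have hQ : ∀ v : ι → ℂ,
      MvPolynomial.eval v Q = MvPolynomial.eval (fun p => A p - B p * v (β p)) F := fun v => by
    rw [← MvPolynomial.coe_aeval_eq_eval, RingHom.coe_coe, MvPolynomial.aeval_bind₁,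
      ← MvPolynomial.coe_aeval_eq_eval]
    simp
  have hinj : ∀ i, Function.Injective fun y : ℤ => ((t i : ℂ) + M * y)⁻¹ := fun i y y' hy => by
    simpa [hM] using hy
  have hQ0 : Q = 0 := by
    refine MvPolynomial.funext_set _ (fun i => Set.infinite_range_of_injective (hinj i)) ?_
    intro v hv
    choose y hy using fun i => hv i (Set.mem_univ i)
    obtain rfl : (fun i => ((t i : ℂ) + M * y i)⁻¹) = v := funext hy
    rw [hQ, h, map_zero]
  rw [← hQ, hQ0, map_zero]

theorem mainTheorem11 (n : ℕ) (G : Set (Fin n → ℍ)) (hG : IsGUT G)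
    (F : MvPolynomial (Fin n × Fin 2) ℂ) (c : Fin n → ℝ) (hc : ∀ i, c i ≠ 0)
    (hconst : ∀ (i : Fin n) (q : ℍ), (∀ τ ∈ G, τ i = q) → c i = q.im)
    (hF : ∀ τ ∈ G, MvPolynomial.eval (fun p : Fin n × Fin 2 =>
      ![jFun (τ p.1), chi (τ p.1) - 3 / ((Real.pi : ℂ) * (c p.1 : ℂ)) * fFun (τ p.1)] p.2) F = 0) :
    ∀ τ ∈ G, MvPolynomial.eval (fun p : Fin n × Fin 2 =>
      ![jFun (τ p.1), chiStar (τ p.1)] p.2) F = 0 := by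
  classical
  obtain ⟨D, hD, rfl⟩ := hG
  intro τ hτ
  obtain ⟨a, b, t, ha, hab, hdef⟩ := D.exists_affine_parametrization hD hτ
  choose N hN hconj using fun s => exists_conj_mem_SL2Z (a s) (b s) (ha s)
  -- A common multiple, so that one deformation is integral in all coordinates at once.
  set M : ℕ := ∏ s, N s
  have hM : M ≠ 0 := Finset.prod_ne_zero_iff.2 fun s _ => (hN s).ne'
  have hMC : (M : ℂ) ≠ 0 := mod_cast hM
  have hconst' : ∀ s, D.block s = 0 →
      chi (τ s) - 3 / ((Real.pi : ℂ) * (c s : ℂ)) * fFun (τ s) = chiStar (τ s) := fun s hs => by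
    rw [hconst s (τ s) fun τ' hτ' => by rw [hτ'.1 s hs, hτ.1 s hs], chi, chiStar, E2Star]
    ring
  -- Constant coordinates do not move; by `hconst'` they already carry the value `χ*`.
  let B : Fin n → ℂ := fun s =>
    if D.block s = 0 then 0 else 6 * Complex.I / Real.pi / a s * fFun (τ s)
  let A : Fin n → ℂ := fun s => if D.block s = 0 then chiStar (τ s) else chi (τ s)
  have key : ∀ y : Fin (D.k + 1) → ℤ, MvPolynomial.eval (fun p : Fin n × Fin 2 =>
      ![jFun (τ p.1), A p.1] p.2 -
        ![0, B p.1] p.2 * ((t (D.block p.1) : ℂ) + M * y (D.block p.1))⁻¹) F = 0 := by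
    intro y
    let z : Fin n → ℂ := fun s => (t (D.block s) : ℂ) + M * y (D.block s)
    have hz : ∀ s, (M : ℂ) * z s ≠ 0 := fun s => mul_ne_zero hMC fun h => by
      have := congrArg Complex.im h
      simp [z] at this
      exact (t (D.block s)).im_ne_zero this
    -- the value of the second function at the deformed point
    let V : ℕ → Fin n → ℂ := fun x s => A s - B s * (M * (x / (1 + x * (M * z s)))) -
      (if D.block s = 0 then 0 else 3 / ((Real.pi : ℂ) * (c s : ℂ)) *
        ((1 + x * (M * z s))⁻¹ ^ 2 * fFun (τ s)))
    have hV : ∀ x : ℕ, MvPolynomial.eval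
        (fun p : Fin n × Fin 2 => ![jFun (τ p.1), V x p.1] p.2) F = 0 := fun x => by
      choose t' ht' using fun i => exists_coe_eq_div (M * x) (M * y i) (t i)
      obtain ⟨τ', hτ', h0, h1⟩ := hdef t'
      rw [← hF τ' hτ']
      congr 2
      ext ⟨s, e⟩
      by_cases hs : D.block s = 0
      · fin_cases e
        · simp [h0 s hs]
        · simp [h0 s hs, V, A, B, hs, hconst' s hs]
      · obtain ⟨γ, hγ, hγ10, hden⟩ := hconj s M (Finset.dvd_prod_of_mem N (Finset.mem_univ s)) x
          (y (D.block s)) (t (D.block s)) (t' (D.block s)) (τ s) (τ' s)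
          (by rw [ht']; push_cast; rfl) (hab s hs) (h1 s hs)
        have hden' : UpperHalfPlane.denom γ (τ s) = 1 + x * (M * z s) := by
          rw [hden]; push_cast; ring
        fin_cases e
        · simpa [← hγ] using (jFun_smul γ (τ s)).symm
        · simp only [← hγ, chi_smul, fFun_smul, hden', hγ10, V, A, B, hs, if_false]
          simp
          ring
    have hlim : Tendsto (fun x : ℕ => fun p : Fin n × Fin 2 => ![jFun (τ p.1), V x p.1] p.2) atTop
        (𝓝 fun p : Fin n × Fin 2 => ![jFun (τ p.1), A p.1] p.2 - ![0, B p.1] p.2 * (z p.1)⁻¹) := by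
      rw [tendsto_pi_nhds]
      rintro ⟨s, e⟩
      fin_cases e
      · simp
      · have e1 := ((tendsto_nat_div_one_add_nat_mul (hz s)).const_mul (M : ℂ)).const_mul (B s)
        -- The only remaining trace of `c` decays quadratically.
        have e2 : Tendsto (fun x : ℕ => if D.block s = 0 then 0 else
            3 / ((Real.pi : ℂ) * (c s : ℂ)) * ((1 + x * (M * z s))⁻¹ ^ 2 * fFun (τ s))) atTop
            (𝓝 0) := by
          by_cases hs : D.block s = 0
          · simp [hs]
          · simpa [hs] using (((tendsto_inv_one_add_nat_mul (hz s)).pow 2).mul_const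
              (fFun (τ s))).const_mul (3 / ((Real.pi : ℂ) * (c s : ℂ)))
        have e3 := (e1.const_sub (A s)).sub e2
        rw [mul_inv, mul_inv_cancel_left₀ hMC, sub_zero] at e3
        simpa [V] using e3
    refine tendsto_nhds_unique (((MvPolynomial.continuous_eval F).tendsto _).comp hlim) ?_
    simp only [Function.comp_def, hV]
    exact tendsto_const_nhds
  -- With `Im τ = a Im t`, this `u` gives `(6i/πa) u = 3/(π Im τ)`.
  rw [← eval_eq_zero_of_forall_int F t hM (fun p : Fin n × Fin 2 => ![jFun (τ p.1), A p.1] p.2)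
    (fun p => ![0, B p.1] p.2) (fun p => D.block p.1) key fun i => (2 * (t i).im * Complex.I)⁻¹]
  congr 2
  ext ⟨s, e⟩
  fin_cases e
  · simp
  · by_cases hs : D.block s = 0
    · simp [A, B, hs]
    · have him : ((τ s).im : ℂ) = a s * (t (D.block s)).im := by
        have := congrArg Complex.im (hab s hs)
        simp at this
        exact_mod_cast this
      have hpi : (Real.pi : ℂ) ≠ 0 := mod_cast Real.pi_ne_zero
      have haC : (a s : ℂ) ≠ 0 := mod_cast (ha s).ne'
      have htC : ((t (D.block s)).im : ℂ) ≠ 0 := mod_cast (t (D.block s)).im_ne_zero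
      simp [A, B, hs, chiStar, chi, E2Star, him]
      field_simp
      rw [Complex.I_sq]
      ring
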